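/- Let $F$ be a distribution function on $\mathbb R$, with tail $\overline F(x)=1-F(x)$, and put $\phi_F(\gamma)=\int_{-\infty}^{\infty}e^{\gamma x}\,dF(x)\in[0,\infty]$. For $\gamma\ge 0$ say that $F\in\mathcal L_\gamma$ if $\overline F(x)>0$ for all $x$ and $\overline F(x-k)/\overline F(x)\to e^{\gamma k}$ as $x\to\infty$ for each fixed $k\in\mathbb R$; and that $F\in\mathcal S_\gamma$ if $F\in\mathcal L_\gamma$, $\phi_F(\gamma)<\infty$, and $\overline{F*F}(x)\sim 2\phi_F(\gamma)\overline F(x)$ as $x\to\infty$. Let $\xi_1,\xi_2,\dots$ be independent random variables with common distribution function $F$, and let $S_0=0$, $S_n=\xi_1+\dots+\xi_n$, $M_n=\max_{0\le i\le n}S_i$, $M=\sup_{n\ge0}S_n$, and, for $n\ge1$, $A_n^{a,x}=\{M_{n-1}\le a,\ S_n>x\}$. **Theorem.** Suppose that $F\in\mathcal S_\gamma$ for some $\gamma>0$ and that $\phi_F(\gamma)<1$. Then $\mathbf E e^{\gamma M}<\infty$ and, given $\epsilon>0$, there exists $a>0$ such that $$(1-\epsilon)\frac{\mathbf E e^{\gamma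 M}}{1-\phi_F(\gamma)}\le\liminf_{x\to\infty}\frac1{\overline F(x)}\,P\Bigl(M>x,\ \bigcup_{n\ge1}A_n^{a,x-a}\Bigr)\le\lim_{x\to\infty}\frac{P(M>x)}{\overline F(x)}=\frac{\mathbf E e^{\gamma M}}{1-\phi_F(\gamma)}.$$ -/

import Mathlib

open MeasureTheory ProbabilityTheory Filter Topology
open scoped ENNReal

noncomputable section

namespace SingleBigJump

/-- The tail `F̄(x) = 1 - F(x) = μ((x, ∞))` of the distribution `μ` on `ℝ` (with distribution
function `F`). -/
def tail (μ : Measure ℝ) (x : ℝ) : ℝ≥0∞ := μ (Set.Ioi x)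

/-- The exponential moment `φ_F(α) = ∫ e^{α x} dF(x) ∈ [0, ∞]`. -/
def phi (μ : Measure ℝ) (α : ℝ) : ℝ≥0∞ := ∫⁻ x, ENNReal.ofReal (Real.exp (α * x)) ∂μ

/-- The class `L_γ`, `γ ≥ 0`, of distributions on `ℝ`. -/
structure LGamma (γ : ℝ) (μ : Measure ℝ) : Prop where
  isProbabilityMeasure : IsProbabilityMeasure μ
  nonneg : 0 ≤ γ
  tail_pos : ∀ x, 0 < tail μ x
  tendsto_tail_sub_div : ∀ k : ℝ,
    Tendsto (fun x => tail μ (x - k) / tail μ x) atTop (𝓝 (ENNReal.ofReal (Real.exp (γ * k))))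

/-- The class `S_γ`, `γ ≥ 0`: distributions in `L_γ` with `φ_F(γ) < ∞` and
`tail of F * F  ~  2 φ_F(γ) F̄` at infinity. -/
structure SGamma (γ : ℝ) (μ : Measure ℝ) : Prop extends LGamma γ μ where
  phi_lt_top : phi μ γ < ∞
  tail_conv_equiv :
    Tendsto (fun x => tail (Measure.conv μ μ) x / (2 * phi μ γ * tail μ x)) atTop (𝓝 1)

variable {Ω : Type*}

/-- The random walk `S_0 = 0`, `S_n = ξ_1 + ⋯ + ξ_n`; the increment `ξ_{i+1}` is `ξ i`. -/
def walk (ξ : ℕ → Ω → ℝ) (n : ℕ) (ω : Ω) : ℝ := ∑ i ∈ Finset.range n, ξ i ω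

/-- The running maximum `M_n = max_{0 ≤ i ≤ n} S_i`. -/
def runMax (ξ : ℕ → Ω → ℝ) (n : ℕ) (ω : Ω) : ℝ :=
  (Finset.range (n + 1)).sup' Finset.nonempty_range_add_one (fun i => walk ξ i ω)

/-- The all-time supremum `M = sup_{n ≥ 0} S_n`, with value `∞` where the walk is unbounded. -/
def allMax (ξ : ℕ → Ω → ℝ) (ω : Ω) : EReal := ⨆ n : ℕ, (walk ξ n ω : EReal)

/-- The expectation `E e^{γ M} ∈ [0, ∞]`. -/
def expMax [MeasurableSpace Ω] (P : Measure Ω) (ξ : ℕ → Ω → ℝ) (γ : ℝ) : ℝ≥0∞ :=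
  ∫⁻ ω, EReal.exp ((γ : EReal) * allMax ξ ω) ∂P

/-- The event `A_n^{a,x} = {M_{n-1} ≤ a, S_n > x}`, for `n ≥ 1`. -/
def jumpEvent (ξ : ℕ → Ω → ℝ) (n : ℕ) (a x : ℝ) : Set Ω :=
  {ω | runMax ξ (n - 1) ω ≤ a ∧ x < walk ξ n ω}

end SingleBigJump

end

namespace SingleBigJump

/-! A high maximum is caused by a single exceptional increment. If that increment is `ξ n`, what
remains is `S_n + M'`, with `M'` the maximum of the walk restarted after it, and this remainder is
independent of `ξ n`. Given remainder `Z`, the jump has probability `F̄(x - Z) ~ e^{γZ} F̄(x)`;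
summing over `n` gives `∑ φ^n E e^{γM} = E e^{γM} / (1 - φ)`.

Lower bound: restricted to `M_n ≤ a` and `M' ≤ a`, these scenarios are disjoint once `x ≥ 2a`.
Fatou's lemma for the sum of the laws (`jumpMeasure`) bounds the liminf below by a truncated
constant, which increases to the full one as `a → ∞`.

Upper bound: `M` is distributed as `max(0, M + ξ)` with `ξ` independent of `M`. Splitting at `M ≤ a`
and using `S_γ` to control the rest (`exists_lintegral_tail_max_le`), `r = limsup P(M > x) / F̄(x)`
satisfies `r ≤ E e^{γM} + r φ`. Solving for `r` requires `r < ∞`, which `exists_uniform_bound`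
supplies by induction along `M_n`. -/

theorem tail_antitone (μ : Measure ℝ) : Antitone (tail μ) := fun _ _ h =>
  measure_mono (Set.Ioi_subset_Ioi h)

theorem measurable_tail (μ : Measure ℝ) : Measurable (tail μ) := (tail_antitone μ).measurable

theorem tail_ne_top (μ : Measure ℝ) [IsFiniteMeasure μ] (x : ℝ) : tail μ x ≠ ∞ :=
  measure_ne_top _ _

theorem tail_le_one (μ : Measure ℝ) [IsProbabilityMeasure μ] (x : ℝ) : tail μ x ≤ 1 :=
  prob_le_one

theorem tail_conv_eq_add (G μ : Measure ℝ) [SFinite G] [SFinite μ] (a x : ℝ) :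
    tail (G.conv μ) x =
      ∫⁻ m in Set.Iic a, tail μ (x - m) ∂G + ∫⁻ y, tail G (max a (x - y)) ∂μ := by
  have hS : MeasurableSet {p : ℝ × ℝ | x < p.1 + p.2} :=
    measurableSet_lt measurable_const (by fun_prop)
  have h1 : tail (G.conv μ) x = (G.prod μ) {p | x < p.1 + p.2} := by
    rw [tail, Measure.conv, Measure.map_apply (by fun_prop) measurableSet_Ioi]
    rfl
  have hA : MeasurableSet {p : ℝ × ℝ | p.1 ≤ a} := measurableSet_le (by fun_prop) (by fun_prop)
  rw [h1, ← measure_inter_add_sdiff _ hA, Measure.prod_apply (hS.inter hA),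
    Measure.prod_apply_symm (hS.diff hA), ← lintegral_indicator measurableSet_Iic]
  congr 1
  · refine lintegral_congr fun m => ?_
    by_cases hm : m ≤ a
    · rw [Set.indicator_of_mem (Set.mem_Iic.2 hm), tail]
      congr 1
      ext y
      simp [hm, sub_lt_iff_lt_add']
    · rw [Set.indicator_of_notMem (by simpa using hm)]
      have : (Prod.mk m ⁻¹' ({p : ℝ × ℝ | x < p.1 + p.2} ∩ {p | p.1 ≤ a})) = ∅ := by
        ext y
        simpa using fun _ => lt_of_not_ge hm
      simp [this]
  · refine lintegral_congr fun y => ?_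
    rw [tail]
    congr 1
    ext m
    simp [sub_lt_iff_lt_add, and_comm]

/-! ### Tail asymptotics in `L_γ`: Fatou and dominated convergence. -/

namespace LGamma

variable {γ : ℝ} {μ : Measure ℝ}

theorem lintegral_exp_le_liminf (h : LGamma γ μ) {α : Type*} [MeasurableSpace α] (ν : Measure α)
    {Z : α → ℝ} (hZ : Measurable Z) :
    ∫⁻ z, ENNReal.ofReal (Real.exp (γ * Z z)) ∂ν ≤
      liminf (fun x => (∫⁻ z, tail μ (x - Z z) ∂ν) / tail μ x) atTop := by
  have hm (x : ℝ) : Measurable fun z => tail μ (x - Z z) :=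
    (measurable_tail μ).comp (measurable_const.sub hZ)
  calc ∫⁻ z, ENNReal.ofReal (Real.exp (γ * Z z)) ∂ν
      = ∫⁻ z, liminf (fun x => tail μ (x - Z z) / tail μ x) atTop ∂ν :=
        lintegral_congr fun z => ((h.tendsto_tail_sub_div (Z z)).liminf_eq).symm
    _ ≤ liminf (fun x => ∫⁻ z, tail μ (x - Z z) / tail μ x ∂ν) atTop :=
        lintegral_liminf_le fun x => (hm x).div_const _
    _ = _ := by
        congr 1
        ext x
        simp_rw [div_eq_mul_inv]
        rw [lintegral_mul_const _ (hm x)]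

theorem tendsto_lintegral_tail (h : LGamma γ μ) {α : Type*} [MeasurableSpace α] (ν : Measure α)
    [IsFiniteMeasure ν] {Z : α → ℝ} (hZ : Measurable Z) {a : ℝ} (ha : ∀ᵐ z ∂ν, Z z ≤ a) :
    Tendsto (fun x => (∫⁻ z, tail μ (x - Z z) ∂ν) / tail μ x) atTop
      (𝓝 (∫⁻ z, ENNReal.ofReal (Real.exp (γ * Z z)) ∂ν)) := by
  have hm (x : ℝ) : Measurable fun z => tail μ (x - Z z) :=
    (measurable_tail μ).comp (measurable_const.sub hZ)
  have key : Tendsto (fun x => ∫⁻ z, tail μ (x - Z z) / tail μ x ∂ν) atTop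
      (𝓝 (∫⁻ z, ENNReal.ofReal (Real.exp (γ * Z z)) ∂ν)) := by
    refine tendsto_lintegral_filter_of_dominated_convergence
      (fun _ => ENNReal.ofReal (Real.exp (γ * a)) + 1)
      (Eventually.of_forall fun x => (hm x).div_const _) ?_ ?_
      (Eventually.of_forall fun z => h.tendsto_tail_sub_div (Z z))
    · have := (h.tendsto_tail_sub_div a).eventually_lt_const
        (ENNReal.lt_add_right ENNReal.ofReal_ne_top one_ne_zero)
      filter_upwards [this] with x hx
      filter_upwards [ha] with z hz
      refine le_trans ?_ hx.le
      gcongr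
      exact tail_antitone μ (by linarith)
    · rw [lintegral_const]
      finiteness
  refine key.congr fun x => ?_
  simp_rw [div_eq_mul_inv]
  rw [lintegral_mul_const _ (hm x)]

end LGamma

/-! ### Convolution estimates in `S_γ`. -/

namespace SGamma

variable {γ : ℝ} {μ : Measure ℝ}

theorem tendsto_tail_conv (h : SGamma γ μ) (h0 : phi μ γ ≠ 0) :
    Tendsto (fun x => tail (μ.conv μ) x / tail μ x) atTop (𝓝 (2 * phi μ γ)) := by
  have := h.isProbabilityMeasure
  have h2 : 2 * phi μ γ ≠ 0 := by simp [h0]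
  have h3 : 2 * phi μ γ ≠ ∞ := ENNReal.mul_ne_top (by simp) h.phi_lt_top.ne
  have := ENNReal.Tendsto.const_mul (a := 2 * phi μ γ) h.tail_conv_equiv (Or.inr h3)
  rw [mul_one] at this
  refine this.congr fun x => ?_
  rw [ENNReal.div_eq_inv_mul, ENNReal.mul_inv (Or.inl h2) (Or.inl h3), ← mul_assoc, ← mul_assoc,
    ENNReal.mul_inv_cancel h2 h3, one_mul, ENNReal.div_eq_inv_mul]

theorem phi_ne_zero (h : SGamma γ μ) : phi μ γ ≠ 0 := by
  have := h.isProbabilityMeasure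
  have hm : Measurable fun x : ℝ => ENNReal.ofReal (Real.exp (γ * x)) := by fun_prop
  rw [phi, Ne, lintegral_eq_zero_iff hm]
  intro h0
  have : ∀ᵐ _ ∂μ, False := h0.mono fun x hx =>
    absurd (by simpa using hx) (Real.exp_pos (γ * x)).not_ge
  simp at this
  exact IsProbabilityMeasure.ne_zero μ this

/-- The integral is the probability that `X + Y > x` with `X > a`. By Fatou the part `X ≤ a` already
takes nearly `φ` out of the total limit `2φ`, so little more than `φ` is left. -/
theorem exists_lintegral_tail_max_le (h : SGamma γ μ) {δ : ℝ≥0∞} (hδ : phi μ γ < δ) :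
    ∃ a₀, ∀ a ≥ a₀, ∀ᶠ x in atTop, ∫⁻ y, tail μ (max a (x - y)) ∂μ ≤ δ * tail μ x := by
  have := h.isProbabilityMeasure
  have hlim : Tendsto (fun n : ℕ => ∫⁻ y in Set.Iic (n : ℝ), ENNReal.ofReal (Real.exp (γ * y)) ∂μ)
      atTop (𝓝 (phi μ γ)) := by
    have hmono : Monotone fun n : ℕ => Set.Iic (n : ℝ) := fun i j hij =>
      Set.Iic_subset_Iic.2 (by exact_mod_cast hij)
    have hU : ⋃ n : ℕ, Set.Iic (n : ℝ) = Set.univ :=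
      Set.eq_univ_of_forall fun x => Set.mem_iUnion.2 (exists_nat_ge x)
    rw [phi, ← setLIntegral_univ, ← hU,
      setLIntegral_iUnion_of_directed _ hmono.directed_le]
    exact tendsto_atTop_iSup fun i j hij => lintegral_mono_set (hmono hij)
  have hφt := h.phi_lt_top.ne
  have hlt : 2 * phi μ γ - δ < phi μ γ := by
    -- The subtraction is truncated: when `δ ≥ 2φ` it is `0`, and `φ > 0` is what is needed.
    rcases le_total δ (2 * phi μ γ) with hle | hle
    · refine ENNReal.sub_lt_of_lt_add hle ?_
      rw [two_mul]
      exact ENNReal.add_lt_add_left hφt hδ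
    · rw [tsub_eq_zero_of_le hle]
      exact pos_iff_ne_zero.2 h.phi_ne_zero
  obtain ⟨n, hn⟩ := (hlim.eventually_const_lt hlt).exists
  refine ⟨n, fun a ha => ?_⟩
  obtain ⟨b, hb1, hb2⟩ := exists_between hn
  have hB := h.toLGamma.lintegral_exp_le_liminf (μ.restrict (Set.Iic a)) measurable_id
  have hB' : b < liminf (fun x => (∫⁻ z in Set.Iic a, tail μ (x - z) ∂μ) / tail μ x) atTop := by
    refine hb2.trans_le (le_trans ?_ hB)
    exact lintegral_mono_set (Set.Iic_subset_Iic.2 ha)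
  have hT : ∀ᶠ x in atTop, tail (μ.conv μ) x / tail μ x < b + δ :=
    (h.tendsto_tail_conv h.phi_ne_zero).eventually_lt_const 
      (ENNReal.lt_add_of_sub_lt_right (Or.inl (ENNReal.mul_ne_top (by simp) hφt)) hb1)
  filter_upwards [eventually_lt_of_lt_liminf hB', hT] with x hx1 hx2
  rw [tail_conv_eq_add μ μ a x, ENNReal.add_div] at hx2
  have h0 := (h.tail_pos x).ne'
  have hbt : b ≠ ∞ := hb2.ne_top
  rw [← ENNReal.div_le_iff h0 (tail_ne_top μ x)]
  refine (ENNReal.add_le_add_iff_left hbt).1 (le_trans ?_ hx2.le)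
  gcongr

/-- One constant survives each step of the maximum recursion because `φ < 1` makes that step a
contraction up to a bounded term. The recursion is only available for `x ≥ 0`; the clause for `x <
0` starts the induction. -/
theorem exists_uniform_bound (h : SGamma γ μ) (hφ : phi μ γ < 1) :
    ∃ C : ℝ≥0∞, C ≠ ∞ ∧ (∀ x < 0, 1 ≤ C * tail μ x) ∧
      ∀ G H : Measure ℝ, IsProbabilityMeasure G → IsProbabilityMeasure H →
        (∀ x, tail G x ≤ C * tail μ x) → (∀ x ≥ 0, tail H x ≤ tail (G.conv μ) x) →
        ∀ x, tail H x ≤ C * tail μ x := by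
  have := h.isProbabilityMeasure
  obtain ⟨δ, hδ1, hδ2⟩ := exists_between hφ
  obtain ⟨a, ha⟩ := h.exists_lintegral_tail_max_le hδ1
  have hK := (h.tendsto_tail_sub_div a).eventually_lt_const
        (ENNReal.lt_add_right ENNReal.ofReal_ne_top one_ne_zero)
  set K := ENNReal.ofReal (Real.exp (γ * a)) + 1
  obtain ⟨x₀, hx₀⟩ := eventually_atTop.1 ((ha a le_rfl).and (hK.and (eventually_ge_atTop 0)))
  have hx00 : 0 ≤ x₀ := (hx₀ x₀ le_rfl).2.2
  -- `K` bounds `F̄(x - a) / F̄(x)` beyond `x₀`; the inverse tail makes the bound trivial up to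
  -- `x₀`. Then `C` solves `L + C δ = C`.
  set L := K + (tail μ x₀)⁻¹
  have hd0 : 1 - δ ≠ 0 := (tsub_pos_of_lt hδ2).ne'
  have hL : L ≠ ∞ := by
    have := (h.tail_pos x₀).ne'
    simp [L, K, this]
  set C := L / (1 - δ)
  have hCt : C ≠ ∞ := ENNReal.div_ne_top hL hd0
  have hC : L + C * δ = C := by
    have : C * (1 - δ) = L := ENNReal.div_mul_cancel hd0 (by simp)
    rw [← this, ← mul_add, tsub_add_cancel_of_le hδ2.le, mul_one]
  have hLC : L ≤ C := hC ▸ le_self_add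
  have h1 (x) (hx : x ≤ x₀) : 1 ≤ C * tail μ x := by
    calc 1 = (tail μ x₀)⁻¹ * tail μ x₀ :=
          (ENNReal.inv_mul_cancel (h.tail_pos x₀).ne' (tail_ne_top _ _)).symm
      _ ≤ C * tail μ x := by
          gcongr
          · exact le_add_self.trans hLC
          · exact tail_antitone μ hx
  refine ⟨C, hCt, fun x hx => h1 x (hx.le.trans hx00), fun G H _ _ hG hH x => ?_⟩
  rcases le_total x x₀ with hx | hx
  · exact (tail_le_one H x).trans (h1 x hx)
  obtain ⟨hJ, hKx, hx0⟩ := hx₀ x hx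
  refine (hH x hx0).trans ?_
  rw [tail_conv_eq_add G μ a x]
  calc _ ≤ ∫⁻ m in Set.Iic a, tail μ (x - a) ∂G + ∫⁻ y, C * tail μ (max a (x - y)) ∂μ := by
        gcongr ?_ + ?_
        · exact setLIntegral_mono measurable_const fun m hm =>
            tail_antitone μ (by have := Set.mem_Iic.1 hm; linarith)
        · exact lintegral_mono fun y => hG _
    _ ≤ K * tail μ x + C * (δ * tail μ x) := by
        gcongr ?_ + ?_
        · rw [setLIntegral_const]
          refine (mul_le_of_le_one_right' prob_le_one).trans ?_
          exact (ENNReal.div_le_iff (h.tail_pos x).ne' (tail_ne_top μ x)).1 hKx.le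
        · rw [lintegral_const_mul' _ _ hCt]
          gcongr
    _ = (K + C * δ) * tail μ x := by ring
    _ ≤ C * tail μ x := by
        gcongr
        conv_rhs => rw [← hC]
        gcongr
        exact le_self_add

theorem limsup_tail_div_le (h : SGamma γ μ) (hφ : phi μ γ < 1) (G : Measure ℝ)
    [IsProbabilityMeasure G] {C : ℝ≥0∞} (hC : C ≠ ∞) (hG : ∀ x, tail G x ≤ C * tail μ x)
    (hconv : ∀ x ≥ 0, tail G x ≤ tail (G.conv μ) x) :
    limsup (fun x => tail G x / tail μ x) atTop ≤ phi G γ / (1 - phi μ γ) := by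
  have := h.isProbabilityMeasure
  set r := limsup (fun x => tail G x / tail μ x) atTop
  have hr : r ≠ ∞ := by
    refine ne_top_of_le_ne_top hC (limsup_le_of_le (by isBoundedDefault) ?_)
    exact Eventually.of_forall fun x => ENNReal.div_le_of_le_mul (hG x)
  have key (s δ : ℝ≥0∞) (hs : r < s) (hst : s ≠ ∞) (hδ : phi μ γ < δ) :
      r ≤ phi G γ + s * δ := by
    obtain ⟨a₀, ha₀⟩ := h.exists_lintegral_tail_max_le hδ
    obtain ⟨a₁, ha₁⟩ := eventually_atTop.1 (eventually_lt_of_limsup_lt hs)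
    have hJ := ha₀ (max a₀ a₁) (le_max_left _ _)
    set a := max a₀ a₁
    have hB := (h.toLGamma.tendsto_lintegral_tail (G.restrict (Set.Iic a)) measurable_id
      (ae_restrict_mem measurableSet_Iic)).add_const (s * δ)
    calc r ≤ limsup (fun x => (∫⁻ z in Set.Iic a, tail μ (x - id z) ∂G) / tail μ x + s * δ)
          atTop := by
          refine limsup_le_limsup ?_
          filter_upwards [hJ, eventually_ge_atTop 0] with x hx hx0
          refine (ENNReal.div_le_div_right (hconv x hx0) _).trans ?_
          rw [tail_conv_eq_add G μ a x, ENNReal.add_div]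
          gcongr
          · exact le_rfl
          refine ENNReal.div_le_of_le_mul ?_
          calc _ ≤ ∫⁻ y, s * tail μ (max a (x - y)) ∂μ := by
                refine lintegral_mono fun y => ?_
                have := ha₁ (max a (x - y)) ((le_max_right _ _).trans (le_max_left _ _))
                exact (ENNReal.div_le_iff (h.tail_pos _).ne' (tail_ne_top μ _)).1 this.le
            _ ≤ s * δ * tail μ x := by
                rw [lintegral_const_mul' _ _ hst, mul_assoc]
                gcongr
      _ = _ := hB.limsup_eq
      _ ≤ _ := by
          gcongr
          exact setLIntegral_le_lintegral _ _
  -- Let `s ↓ r` and `δ ↓ φ` along `1 / n`.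
  have hfin : r ≤ phi G γ + r * phi μ γ := by
    have hinv := ENNReal.tendsto_inv_nat_nhds_zero
    have hlim : Tendsto (fun n : ℕ => phi G γ + (r + (n : ℝ≥0∞)⁻¹) * (phi μ γ + (n : ℝ≥0∞)⁻¹)) atTop
        (𝓝 (phi G γ + (r + 0) * (phi μ γ + 0))) :=
      (ENNReal.Tendsto.mul (hinv.const_add r) (Or.inr (by simpa using h.phi_lt_top.ne))
        (hinv.const_add _) (Or.inr (by simpa using hr))).const_add _
    rw [add_zero, add_zero] at hlim
    refine ge_of_tendsto hlim ?_
    filter_upwards [eventually_ne_atTop 0] with n hn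
    have hn0 : (n : ℝ≥0∞)⁻¹ ≠ 0 := by simp
    exact key _ _ (ENNReal.lt_add_right hr hn0) (by simp [hr, hn])
      (ENNReal.lt_add_right h.phi_lt_top.ne hn0)
  rw [ENNReal.le_div_iff_mul_le (Or.inl (tsub_pos_of_lt hφ).ne') (Or.inl (by simp)),
    ENNReal.mul_sub (fun _ _ => hr), mul_one]
  exact tsub_le_iff_right.2 hfin

end SGamma

/-! ### Pathwise properties of the walk and its maxima. -/

variable {Ω : Type*}

theorem walk_add (ξ : ℕ → Ω → ℝ) (k n : ℕ) (ω : Ω) :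
    walk ξ (k + n) ω = walk ξ k ω + walk (fun i => ξ (i + k)) n ω := by
  simp only [walk, Finset.sum_range_add, add_comm]

theorem walk_le_runMax (ξ : ℕ → Ω → ℝ) {i n : ℕ} (h : i ≤ n) (ω : Ω) :
    walk ξ i ω ≤ runMax ξ n ω :=
  Finset.le_sup' (fun i => walk ξ i ω) (Finset.mem_range.2 (Nat.lt_succ_of_le h))

theorem lt_runMax_iff (ξ : ℕ → Ω → ℝ) (n : ℕ) (ω : Ω) (x : ℝ) :
    x < runMax ξ n ω ↔ ∃ i ≤ n, x < walk ξ i ω := by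
  simp [runMax, Finset.lt_sup'_iff]

theorem lt_allMax_iff (ξ : ℕ → Ω → ℝ) (ω : Ω) (x : ℝ) :
    (x : EReal) < allMax ξ ω ↔ ∃ i, x < walk ξ i ω := by
  simp [allMax, lt_iSup_iff]

theorem walk_le_allMax (ξ : ℕ → Ω → ℝ) (n : ℕ) (ω : Ω) : (walk ξ n ω : EReal) ≤ allMax ξ ω :=
  le_iSup (fun n => (walk ξ n ω : EReal)) n

theorem allMax_nonneg (ξ : ℕ → Ω → ℝ) (ω : Ω) : 0 ≤ allMax ξ ω := by
  simpa [walk] using walk_le_allMax ξ 0 ω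

theorem allMax_ne_bot (ξ : ℕ → Ω → ℝ) (ω : Ω) : allMax ξ ω ≠ ⊥ :=
  (lt_of_lt_of_le EReal.bot_lt_zero (allMax_nonneg ξ ω)).ne'

theorem walk_add_allMax_le (ξ : ℕ → Ω → ℝ) (k : ℕ) (ω : Ω) :
    ((walk ξ k ω + (allMax (fun i => ξ (i + k)) ω).toReal : ℝ) : EReal) ≤ allMax ξ ω := by
  -- `toReal` sends `⊤` to `0`, so this inequality holds on every path.
  have h1 := EReal.coe_toReal_le (allMax_ne_bot (fun i => ξ (i + k)) ω)
  rw [EReal.coe_add, add_comm]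
  refine EReal.add_le_of_le_sub (h1.trans (iSup_le fun n => ?_))
  refine EReal.le_sub_iff_add_le (by simp) (by simp) |>.2 ?_
  rw [add_comm, ← EReal.coe_add, ← walk_add]
  exact walk_le_allMax ξ _ ω

theorem lt_allMax_iff_of_nonneg (ξ : ℕ → Ω → ℝ) (ω : Ω) {x : ℝ} (hx : 0 ≤ x) :
    (x : EReal) < allMax ξ ω ↔ ((x - ξ 0 ω : ℝ) : EReal) < allMax (fun i => ξ (i + 1)) ω := by
  have h (n) : walk ξ (n + 1) ω = ξ 0 ω + walk (fun i => ξ (i + 1)) n ω := by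
    rw [add_comm n 1, walk_add]
    simp [walk]
  rw [lt_allMax_iff, lt_allMax_iff]
  constructor
  · rintro ⟨_ | i, hi⟩
    · exact absurd hi (by simpa [walk] using hx)
    · exact ⟨i, by linarith [h i]⟩
  · rintro ⟨i, hi⟩
    exact ⟨i + 1, by linarith [h i]⟩

theorem lt_runMax_succ_iff (ξ : ℕ → Ω → ℝ) (n : ℕ) (ω : Ω) {x : ℝ} (hx : 0 ≤ x) :
    x < runMax ξ (n + 1) ω ↔ x < runMax (fun i => ξ (i + 1)) n ω + ξ 0 ω := by
  have h (n) : walk ξ (n + 1) ω = ξ 0 ω + walk (fun i => ξ (i + 1)) n ω := by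
    rw [add_comm n 1, walk_add]
    simp [walk]
  rw [← sub_lt_iff_lt_add, lt_runMax_iff, lt_runMax_iff]
  constructor
  · rintro ⟨_ | i, hin, hi⟩
    · exact absurd hi (by simpa [walk] using hx)
    · exact ⟨i, by lia, by linarith [h i]⟩
  · rintro ⟨i, hin, hi⟩
    exact ⟨i + 1, by lia, by linarith [h i]⟩

theorem measurable_walk {_ : MeasurableSpace Ω} {ξ : ℕ → Ω → ℝ} {n : ℕ}
    (h : ∀ i < n, Measurable (ξ i)) : Measurable (walk ξ n) :=
  Finset.measurable_fun_sum _ fun i hi => h i (Finset.mem_range.1 hi)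

theorem measurable_runMax {_ : MeasurableSpace Ω} {ξ : ℕ → Ω → ℝ} {n : ℕ}
    (h : ∀ i < n, Measurable (ξ i)) : Measurable (runMax ξ n) :=
  Finset.measurable_range_sup'' fun _ hk => measurable_walk fun i hi => h i (hi.trans_le hk)

theorem measurable_allMax {_ : MeasurableSpace Ω} {ξ : ℕ → Ω → ℝ}
    (h : ∀ i, Measurable (ξ i)) : Measurable (allMax ξ) :=
  Measurable.iSup fun _ => (measurable_walk fun i _ => h i).coe_real_ereal

theorem exp_allMax_le_tsum (ξ : ℕ → Ω → ℝ) (ω : Ω) {γ : ℝ} (hγ : 0 < γ) :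
    EReal.exp ((γ : EReal) * allMax ξ ω) ≤
      ∑' n, ENNReal.ofReal (Real.exp (γ * walk ξ n ω)) := by
  set T := ∑' n, ENNReal.ofReal (Real.exp (γ * walk ξ n ω))
  have hT : T = EReal.exp (ENNReal.log T) := by simp
  have hγ' : (0 : EReal) < γ := by exact_mod_cast hγ
  rw [hT, EReal.exp_le_exp_iff, mul_comm, ← EReal.le_div_iff_mul_le hγ' (EReal.coe_ne_top _)]
  refine iSup_le fun n => ?_
  rw [EReal.le_div_iff_mul_le hγ' (EReal.coe_ne_top _), mul_comm, ← EReal.exp_le_exp_iff, ← hT,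
    ← EReal.coe_mul, EReal.exp_coe]
  exact ENNReal.le_tsum n

/-! ### Independence, shift invariance and exponential moments. -/

variable [MeasurableSpace Ω] {P : Measure Ω} {μ : Measure ℝ} {γ : ℝ} {ξ : ℕ → Ω → ℝ}

/-- Quantifying over every σ-algebra `m` lets `hf` and `hg` be applied to those generated by the
increments in `S` and in `T`. -/
theorem indepFun_of_disjoint (hmeas : ∀ n, Measurable (ξ n)) (hindep : iIndepFun ξ P)
    {S T : Set ℕ} (hST : Disjoint S T) {β β' : Type*} [mβ : MeasurableSpace β]
    [mβ' : MeasurableSpace β'] {f : Ω → β} {g : Ω → β'}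
    (hf : ∀ m : MeasurableSpace Ω, (∀ i ∈ S, Measurable[m] (ξ i)) → Measurable[m] f)
    (hg : ∀ m : MeasurableSpace Ω, (∀ i ∈ T, Measurable[m] (ξ i)) → Measurable[m] g) :
    IndepFun f g P := by
  have h := indep_iSup_of_disjoint (fun n => (hmeas n).comap_le)
    ((iIndepFun_iff_iIndep ..).1 hindep) hST
  rw [IndepFun_iff_Indep]
  refine indep_of_indep_of_le_left (indep_of_indep_of_le_right h ?_) ?_
  · exact (hg _ fun i hi => (comap_measurable (ξ i)).mono
      (le_iSup₂ (f := fun i (_ : i ∈ T) => MeasurableSpace.comap (ξ i) inferInstance) i hi)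
      le_rfl).comap_le
  · exact (hf _ fun i hi => (comap_measurable (ξ i)).mono
      (le_iSup₂ (f := fun i (_ : i ∈ S) => MeasurableSpace.comap (ξ i) inferInstance) i hi)
      le_rfl).comap_le

theorem map_shift [IsProbabilityMeasure P] (hmeas : ∀ n, Measurable (ξ n))
    (hindep : iIndepFun ξ P) (hlaw : ∀ n, P.map (ξ n) = μ) (k : ℕ) :
    P.map (fun ω i => ξ (i + k) ω) = P.map (fun ω i => ξ i ω) := by
  have h1 := (hindep.precomp (add_left_injective k)).map_fun_eq_infinitePi_map
    fun i => hmeas (i + k)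
  have h2 := hindep.map_fun_eq_infinitePi_map hmeas
  simp only [hlaw] at h1 h2
  exact h1.trans h2.symm

theorem measure_mem_inter_lt_add [IsFiniteMeasure P] {β : Type*} [MeasurableSpace β] {Y : Ω → β}
    {X : Ω → ℝ} (hY : Measurable Y) (hX : Measurable X) (hYX : IndepFun Y X P) {b : Set β}
    (hb : MeasurableSet b) {f : β → ℝ} (hf : Measurable f) (x : ℝ) :
    P {ω | Y ω ∈ b ∧ x < f (Y ω) + X ω} =
      ∫⁻ y in b, tail (P.map X) (x - f y) ∂(P.map Y) := by
  have hS : MeasurableSet {p : β × ℝ | p.1 ∈ b ∧ x < f p.1 + p.2} :=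
    (measurable_fst hb).inter (measurableSet_lt measurable_const
      ((hf.comp measurable_fst).add measurable_snd))
  have h1 : P {ω | Y ω ∈ b ∧ x < f (Y ω) + X ω} =
      P.map (fun ω => (Y ω, X ω)) {p : β × ℝ | p.1 ∈ b ∧ x < f p.1 + p.2} := by
    rw [Measure.map_apply (hY.prodMk hX) hS]
    rfl
  rw [h1, hYX.map_prod_eq_prod_map_map hY.aemeasurable hX.aemeasurable, Measure.prod_apply hS,
    ← lintegral_indicator hb]
  refine lintegral_congr fun y => ?_
  by_cases hy : y ∈ b
  · rw [Set.indicator_of_mem hy, tail]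
    congr 1
    ext z
    simp [hy, sub_lt_iff_lt_add']
  · rw [Set.indicator_of_notMem hy]
    simp [hy]

theorem lintegral_exp_walk (hmeas : ∀ n, Measurable (ξ n))
    (hindep : iIndepFun ξ P) (hlaw : ∀ n, P.map (ξ n) = μ) (n : ℕ) :
    ∫⁻ ω, ENNReal.ofReal (Real.exp (γ * walk ξ n ω)) ∂P = phi μ γ ^ n := by
  have hm : Measurable fun x : ℝ => ENNReal.ofReal (Real.exp (γ * x)) := by fun_prop
  have h := lintegral_prod_eq_prod_lintegral_of_indepFun (Finset.range n)
    (fun i ω => ENNReal.ofReal (Real.exp (γ * ξ i ω))) (hindep.comp (fun _ => _) fun _ => hm)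
    fun i => hm.comp (hmeas i)
  have h2 (i) : ∫⁻ ω, ENNReal.ofReal (Real.exp (γ * ξ i ω)) ∂P = phi μ γ := by
    rw [phi, ← hlaw i, lintegral_map hm (hmeas i)]
  simp only [h2, Finset.prod_const, Finset.card_range] at h
  rw [← h]
  refine lintegral_congr fun ω => ?_
  rw [walk, Finset.mul_sum, Real.exp_sum, ENNReal.ofReal_prod_of_nonneg]
  exact fun _ _ => (Real.exp_pos _).le

theorem expMax_lt_top (hγ : 0 < γ) (hφ : phi μ γ < 1) (hmeas : ∀ n, Measurable (ξ n))
    (hindep : iIndepFun ξ P) (hlaw : ∀ n, P.map (ξ n) = μ) : expMax P ξ γ < ∞ := by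
  calc expMax P ξ γ
      ≤ ∫⁻ ω, ∑' n, ENNReal.ofReal (Real.exp (γ * walk ξ n ω)) ∂P :=
        lintegral_mono fun ω => exp_allMax_le_tsum ξ ω hγ
    _ = ∑' n, phi μ γ ^ n := by
        rw [lintegral_tsum]
        · simp_rw [lintegral_exp_walk hmeas hindep hlaw]
        · intro n
          have := measurable_walk (n := n) fun i _ => hmeas i
          fun_prop
    _ = (1 - phi μ γ)⁻¹ := ENNReal.tsum_geometric _
    _ < ∞ := by simp [hφ]

theorem ae_allMax_ne_top (hγ : 0 < γ) (hmeas : ∀ n, Measurable (ξ n))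
    (h : expMax P ξ γ < ∞) : ∀ᵐ ω ∂P, allMax ξ ω ≠ ⊤ := by
  have hm := measurable_allMax hmeas
  have hm' : Measurable fun ω => EReal.exp ((γ : EReal) * allMax ξ ω) := by
    refine Measurable.comp (g := fun e : EReal => EReal.exp (γ * e))
      (EReal.measurable_of_measurable_real ?_) hm
    simp only [← EReal.coe_mul, EReal.exp_coe]
    fun_prop
  filter_upwards [ae_lt_top hm' h.ne] with ω hω htop
  simp [htop, EReal.coe_mul_top_of_pos hγ] at hω

theorem lintegral_exp_allMax_shift [IsProbabilityMeasure P] (hγ : 0 < γ)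
    (hmeas : ∀ n, Measurable (ξ n)) (hindep : iIndepFun ξ P) (hlaw : ∀ n, P.map (ξ n) = μ)
    (h : expMax P ξ γ < ∞) (k : ℕ) :
    ∫⁻ ω, ENNReal.ofReal (Real.exp (γ * (allMax (fun i => ξ (i + k)) ω).toReal)) ∂P =
      expMax P ξ γ := by
  have hm0 : Measurable (allMax (fun i (s : ℕ → ℝ) => s i)) :=
    measurable_allMax fun i => measurable_pi_apply i
  have hm : Measurable fun s : ℕ → ℝ =>
      ENNReal.ofReal (Real.exp (γ * (allMax (fun i (s : ℕ → ℝ) => s i) s).toReal)) := by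
    have := hm0.ereal_toReal
    fun_prop
  calc _ = ∫⁻ ω, ENNReal.ofReal (Real.exp (γ * (allMax ξ ω).toReal)) ∂P := by
        have h1 := lintegral_map (μ := P) hm (measurable_pi_lambda _ fun i => hmeas (i + k))
        have h2 := lintegral_map (μ := P) hm (measurable_pi_lambda _ hmeas)
        rw [map_shift hmeas hindep hlaw k] at h1
        exact h1.symm.trans h2
    _ = _ := by
        refine lintegral_congr_ae ((ae_allMax_ne_top hγ hmeas h).mono fun ω hω => ?_)
        dsimp only
        rw [← EReal.exp_coe, EReal.coe_mul, EReal.coe_toReal hω (allMax_ne_bot ξ ω)]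

theorem tail_map_runMax_le [IsProbabilityMeasure P] (hmeas : ∀ n, Measurable (ξ n))
    (hindep : iIndepFun ξ P) (hlaw : ∀ n, P.map (ξ n) = μ) (n : ℕ) {x : ℝ} (hx : 0 ≤ x) :
    tail (P.map (runMax ξ (n + 1))) x = tail ((P.map (runMax ξ n)).conv μ) x := by
  have hm1 : Measurable (runMax (fun i => ξ (i + 1)) n) :=
    measurable_runMax fun i _ => hmeas (i + 1)
  have h1 : P.map (runMax ξ n) = P.map (runMax (fun i => ξ (i + 1)) n) := by
    have hm : Measurable (runMax (fun i (s : ℕ → ℝ) => s i) n) :=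
      measurable_runMax fun i _ => measurable_pi_apply i
    have h1 := Measure.map_map (μ := P) hm (measurable_pi_lambda _ fun i => hmeas (i + 1))
    have h2 := Measure.map_map (μ := P) hm (measurable_pi_lambda _ hmeas)
    rw [map_shift hmeas hindep hlaw 1] at h1
    exact h2.symm.trans h1
  have h2 : IndepFun (runMax (fun i => ξ (i + 1)) n) (ξ 0) P :=
    indepFun_of_disjoint hmeas hindep (S := {0}ᶜ) (T := {0}) disjoint_compl_left
      (fun m hm => measurable_runMax fun i _ => hm (i + 1) (by simp)) fun m hm => hm 0 rfl
  rw [h1, ← hlaw 0, ← h2.map_add_eq_map_conv_map hm1 (hmeas 0), tail, tail,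
    Measure.map_apply (measurable_runMax fun i _ => hmeas i) measurableSet_Ioi,
    Measure.map_apply (hm1.add (hmeas 0)) measurableSet_Ioi]
  congr 1
  ext ω
  exact lt_runMax_succ_iff ξ n ω hx

theorem tail_map_allMax_eq [IsProbabilityMeasure P] (hmeas : ∀ n, Measurable (ξ n))
    (hfin : ∀ᵐ ω ∂P, allMax ξ ω ≠ ⊤) (x : ℝ) :
    tail (P.map fun ω => (allMax ξ ω).toReal) x = P {ω | (x : EReal) < allMax ξ ω} := by
  rw [tail, Measure.map_apply (measurable_allMax hmeas).ereal_toReal measurableSet_Ioi]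
  refine measure_congr (hfin.mono fun ω hω => propext ?_)
  change x < (allMax ξ ω).toReal ↔ (x : EReal) < allMax ξ ω
  rw [← EReal.coe_lt_coe_iff, EReal.coe_toReal hω (allMax_ne_bot ξ ω)]

theorem measure_lt_allMax_eq_tail_conv [IsProbabilityMeasure P]
    (hmeas : ∀ n, Measurable (ξ n))
    (hindep : iIndepFun ξ P) (hlaw : ∀ n, P.map (ξ n) = μ)
    (hfin : ∀ᵐ ω ∂P, allMax ξ ω ≠ ⊤) {x : ℝ} (hx : 0 ≤ x) :
    P {ω | (x : EReal) < allMax ξ ω} =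
      tail ((P.map fun ω => (allMax ξ ω).toReal).conv μ) x := by
  have hm1 : Measurable fun ω => (allMax (fun i => ξ (i + 1)) ω).toReal :=
    measurable_ereal_toReal.comp (measurable_allMax fun i => hmeas (i + 1))
  have h1 : (P.map fun ω => (allMax ξ ω).toReal) =
      P.map fun ω => (allMax (fun i => ξ (i + 1)) ω).toReal := by
    have hm : Measurable fun s => (allMax (fun i (s : ℕ → ℝ) => s i) s).toReal :=
      measurable_ereal_toReal.comp (measurable_allMax fun i => measurable_pi_apply i)
    have h1 := Measure.map_map (μ := P) hm (measurable_pi_lambda _ fun i => hmeas (i + 1))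
    have h2 := Measure.map_map (μ := P) hm (measurable_pi_lambda _ hmeas)
    rw [map_shift hmeas hindep hlaw 1] at h1
    exact h2.symm.trans h1
  have h2 : IndepFun (fun ω => (allMax (fun i => ξ (i + 1)) ω).toReal) (ξ 0) P :=
    indepFun_of_disjoint hmeas hindep (S := {0}ᶜ) (T := {0}) disjoint_compl_left
      (fun m hm => measurable_ereal_toReal.comp (measurable_allMax fun i => hm (i + 1) (by simp)))
      fun m hm => hm 0 rfl
  rw [h1, ← hlaw 0, ← h2.map_add_eq_map_conv_map hm1 (hmeas 0), tail,
    Measure.map_apply (hm1.add (hmeas 0)) measurableSet_Ioi]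
  refine measure_congr (hfin.mono fun ω hω => propext ?_)
  change (x : EReal) < allMax ξ ω ↔ x < (allMax (fun i => ξ (i + 1)) ω).toReal + ξ 0 ω
  have htop : allMax (fun i => ξ (i + 1)) ω ≠ ⊤ := fun ht => hω <| by
    refine (EReal.eq_top_iff_forall_lt _).2 fun y => ?_
    refine (EReal.coe_le_coe_iff.2 (le_max_left y 0)).trans_lt ?_
    rw [lt_allMax_iff_of_nonneg ξ ω (le_max_right y 0), ht]
    exact EReal.coe_lt_top _
  rw [lt_allMax_iff_of_nonneg ξ ω hx, ← EReal.coe_toReal htop (allMax_ne_bot _ ω),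
    EReal.coe_lt_coe_iff, EReal.toReal_coe, sub_lt_iff_lt_add]

end SingleBigJump

/-! ### The walk with one increment left out. -/

namespace SingleBigJump

variable {Ω : Type*}

/-- Two statistics of the walk that do not involve the increment `ξ n`: the larger of the running
maximum `M_n` before it and the maximum `M'` of the walk restarted after it, and `S_n + M'`. -/
noncomputable def aroundJump (ξ : ℕ → Ω → ℝ) (n : ℕ) (ω : Ω) : ℝ × ℝ :=
  (max (runMax ξ n ω) (allMax (fun i => ξ (i + (n + 1))) ω).toReal,
    walk ξ n ω + (allMax (fun i => ξ (i + (n + 1))) ω).toReal)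

theorem measurable_aroundJump {_ : MeasurableSpace Ω} {ξ : ℕ → Ω → ℝ} {n : ℕ}
    (h : ∀ i, i ≠ n → Measurable (ξ i)) :
    Measurable (aroundJump ξ n) := by
  have h1 : Measurable (walk ξ n) := measurable_walk fun i hi => h i hi.ne
  have h2 : Measurable (runMax ξ n) := measurable_runMax fun i hi => h i hi.ne
  have h3 : Measurable fun ω => (allMax (fun i => ξ (i + (n + 1))) ω).toReal :=
    (measurable_allMax fun i => h _ (by lia)).ereal_toReal
  exact (h2.max h3).prodMk (h1.add h3)

variable [MeasurableSpace Ω] {P : Measure Ω} {μ : Measure ℝ} {γ : ℝ} {ξ : ℕ → Ω → ℝ}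

/-! ### Upper bound for the tail of `M`. -/

theorem exists_measure_lt_allMax_le [IsProbabilityMeasure P] (h : SGamma γ μ)
    (hφ : phi μ γ < 1) (hmeas : ∀ n, Measurable (ξ n)) (hindep : iIndepFun ξ P)
    (hlaw : ∀ n, P.map (ξ n) = μ) :
    ∃ C : ℝ≥0∞, C ≠ ∞ ∧ ∀ x : ℝ, P {ω | (x : EReal) < allMax ξ ω} ≤ C * tail μ x := by
  obtain ⟨C, hC, hneg, hstep⟩ := h.exists_uniform_bound hφ
  have hm (n) : Measurable (runMax ξ n) := measurable_runMax fun i _ => hmeas i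
  have hprob (n) : IsProbabilityMeasure (P.map (runMax ξ n)) :=
    Measure.isProbabilityMeasure_map (hm n).aemeasurable
  have hn (n : ℕ) : ∀ x, tail (P.map (runMax ξ n)) x ≤ C * tail μ x := by
    induction n with
    | zero =>
      intro x
      rcases lt_or_ge x 0 with hx | hx
      · exact (tail_le_one _ _).trans (hneg x hx)
      · rw [tail, Measure.map_apply (hm 0) measurableSet_Ioi]
        have : runMax ξ 0 ⁻¹' Set.Ioi x = ∅ := by
          ext ω
          simpa [runMax, walk] using hx
        simp [this]
    | succ n ih =>
      exact hstep _ _ (hprob n) (hprob (n + 1)) ih fun x hx =>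
        (tail_map_runMax_le hmeas hindep hlaw n hx).le
  refine ⟨C, hC, fun x => ?_⟩
  have hU : {ω | (x : EReal) < allMax ξ ω} = ⋃ n, {ω | x < runMax ξ n ω} := by
    ext ω
    simp only [Set.mem_ofPred_eq, Set.mem_iUnion, lt_allMax_iff, lt_runMax_iff]
    exact ⟨fun ⟨i, hi⟩ => ⟨i, i, le_rfl, hi⟩, fun ⟨_, i, _, hi⟩ => ⟨i, hi⟩⟩
  have hmono : Monotone fun n => {ω | x < runMax ξ n ω} := fun i j hij ω hω => by
    obtain ⟨k, hk, hx⟩ := (lt_runMax_iff ξ i ω x).1 hω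
    exact (lt_runMax_iff ξ j ω x).2 ⟨k, hk.trans hij, hx⟩
  rw [hU, hmono.measure_iUnion]
  refine iSup_le fun n => ?_
  refine le_trans (le_of_eq ?_) (hn n x)
  rw [tail, Measure.map_apply (hm n) measurableSet_Ioi]
  rfl

theorem limsup_measure_lt_allMax_le [IsProbabilityMeasure P] (hγ : 0 < γ) (h : SGamma γ μ)
    (hφ : phi μ γ < 1) (hmeas : ∀ n, Measurable (ξ n)) (hindep : iIndepFun ξ P)
    (hlaw : ∀ n, P.map (ξ n) = μ) :
    limsup (fun x : ℝ => P {ω | (x : EReal) < allMax ξ ω} / tail μ x) atTop ≤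
      expMax P ξ γ / (1 - phi μ γ) := by
  have hE := expMax_lt_top hγ hφ hmeas hindep hlaw
  have hfin := ae_allMax_ne_top hγ hmeas hE
  have hm : Measurable fun ω => (allMax ξ ω).toReal := (measurable_allMax hmeas).ereal_toReal
  have : IsProbabilityMeasure (P.map fun ω => (allMax ξ ω).toReal) :=
    Measure.isProbabilityMeasure_map hm.aemeasurable
  obtain ⟨C, hC, hle⟩ := exists_measure_lt_allMax_le h hφ hmeas hindep hlaw
  have key := h.limsup_tail_div_le hφ (P.map fun ω => (allMax ξ ω).toReal) hC
    (fun x => (tail_map_allMax_eq hmeas hfin x).trans_le (hle x))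
    (fun x hx => by
      rw [tail_map_allMax_eq hmeas hfin x,
        measure_lt_allMax_eq_tail_conv hmeas hindep hlaw hfin hx])
  have hphi : phi (P.map fun ω => (allMax ξ ω).toReal) γ = expMax P ξ γ := by
    rw [phi, lintegral_map (by fun_prop) hm]
    exact lintegral_exp_allMax_shift hγ hmeas hindep hlaw hE 0
  simpa only [tail_map_allMax_eq hmeas hfin, hphi] using key

/-! ### Lower bound through the occupation measure. -/

/-- The occupation measure `∑ₙ law (aroundJump ξ n)`. -/
noncomputable def jumpMeasure (P : Measure Ω) (ξ : ℕ → Ω → ℝ) : Measure (ℝ × ℝ) :=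
  Measure.sum fun n => P.map (aroundJump ξ n)

theorem lintegral_exp_jumpMeasure [IsProbabilityMeasure P] (hγ : 0 < γ)
    (hφ : phi μ γ < 1) (hmeas : ∀ n, Measurable (ξ n)) (hindep : iIndepFun ξ P)
    (hlaw : ∀ n, P.map (ξ n) = μ) :
    ∫⁻ p, ENNReal.ofReal (Real.exp (γ * p.2)) ∂(jumpMeasure P ξ) =
      expMax P ξ γ / (1 - phi μ γ) := by
  have hE := expMax_lt_top hγ hφ hmeas hindep hlaw
  rw [jumpMeasure, lintegral_sum_measure, ENNReal.div_eq_inv_mul, ← ENNReal.tsum_geometric,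
    ← ENNReal.tsum_mul_right]
  refine tsum_congr fun n => ?_
  have hexp : Measurable fun x : ℝ => ENNReal.ofReal (Real.exp (γ * x)) := by fun_prop
  have hind : IndepFun (walk ξ n) (fun ω => (allMax (fun i => ξ (i + (n + 1))) ω).toReal) P :=
    indepFun_of_disjoint hmeas hindep (S := Set.Iic n) (T := Set.Ioi n)
      (Set.Iic_disjoint_Ioi le_rfl) (fun m hm => measurable_walk fun i hi => hm i hi.le)
      fun m hm => (measurable_allMax fun i => hm _ (by simp; lia)).ereal_toReal
  have hprod := lintegral_mul_eq_lintegral_mul_lintegral_of_indepFun''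
    (hexp.comp (measurable_walk fun i _ => hmeas i)).aemeasurable
    (hexp.comp (measurable_allMax fun i => hmeas _).ereal_toReal).aemeasurable
    (hind.comp hexp hexp)
  rw [lintegral_map (by fun_prop) (measurable_aroundJump fun i _ => hmeas i),
    ← lintegral_exp_walk hmeas hindep hlaw n,
    ← lintegral_exp_allMax_shift hγ hmeas hindep hlaw hE (n + 1)]
  refine Eq.trans (lintegral_congr fun ω => ?_) hprod
  rw [aroundJump, mul_add, Real.exp_add, ENNReal.ofReal_mul (Real.exp_pos _).le]
  rfl

theorem setLIntegral_tail_jumpMeasure_le [IsProbabilityMeasure P] (hmeas : ∀ n, Measurable (ξ n))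
    (hindep : iIndepFun ξ P) (hlaw : ∀ n, P.map (ξ n) = μ) {a x : ℝ} (hx : 2 * a ≤ x) :
    ∫⁻ p in {p | p.1 ≤ a}, tail μ (x - p.2) ∂(jumpMeasure P ξ) ≤
      P ({ω | (x : EReal) < allMax ξ ω} ∩ ⋃ (n : ℕ) (_ : 1 ≤ n), jumpEvent ξ n a (x - a)) := by
  set E : ℕ → Set Ω := fun n =>
    {ω | aroundJump ξ n ω ∈ {p : ℝ × ℝ | p.1 ≤ a} ∧ x < (aroundJump ξ n ω).2 + ξ n ω}
  have hb : MeasurableSet {p : ℝ × ℝ | p.1 ≤ a} := measurableSet_le (by fun_prop) (by fun_prop)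
  have hma (n) : Measurable (aroundJump ξ n) := measurable_aroundJump fun i _ => hmeas i
  have hP (n : ℕ) : ∫⁻ p in {p | p.1 ≤ a}, tail μ (x - p.2) ∂(P.map (aroundJump ξ n)) =
      P (E n) := by
    have hind : IndepFun (aroundJump ξ n) (ξ n) P :=
      indepFun_of_disjoint hmeas hindep (S := {n}ᶜ) (T := {n}) disjoint_compl_left
        (fun m hm => measurable_aroundJump fun i hi => hm i hi) fun m hm => hm n rfl
    rw [measure_mem_inter_lt_add (hma n) (hmeas n) hind hb measurable_snd, hlaw]
  have hwalk (n ω) : walk ξ (n + 1) ω = walk ξ n ω + ξ n ω := Finset.sum_range_succ _ _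
  have hjump (n : ℕ) : E n ⊆ jumpEvent ξ (n + 1) a (x - a) := by
    rintro ω ⟨h1, h2⟩
    simp only [aroundJump, Set.mem_ofPred_eq, max_le_iff] at h1 h2
    refine ⟨h1.1, ?_⟩
    rw [hwalk]
    linarith [h1.2]
  have hsub : ⋃ n, E n ⊆
      {ω | (x : EReal) < allMax ξ ω} ∩ ⋃ (n : ℕ) (_ : 1 ≤ n), jumpEvent ξ n a (x - a) := by
    refine Set.iUnion_subset fun n ω hω => ⟨?_, ?_⟩
    · refine lt_of_lt_of_le (EReal.coe_lt_coe_iff.2 ?_) (walk_add_allMax_le ξ (n + 1) ω)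
      have := hω.2
      simp only [aroundJump] at this
      rw [hwalk]
      linarith
    · exact Set.mem_iUnion₂.2 ⟨n + 1, by lia, hjump n hω⟩
  -- On `E i` the walk satisfies `S_{i+1} > x - a ≥ a`, while `E j` with `j > i` keeps `M_j ≤ a`.
  have hdisj : Pairwise (Function.onFun Disjoint E) := by
    rw [pairwise_disjoint_on]
    refine fun i j hij => Set.disjoint_left.2 fun ω hi hj => ?_
    have h1 := (hjump i hi).2
    have h2 := (hjump j hj).1
    have h3 := walk_le_runMax ξ (i := i + 1) (n := j + 1 - 1) (by lia) ω
    linarith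
  have hmE (n) : MeasurableSet (E n) :=
    (hma n hb).inter (measurableSet_lt measurable_const ((hma n).snd.add (hmeas n)))
  calc _ = ∑' n, P (E n) := by
        rw [jumpMeasure, Measure.restrict_sum _ hb, lintegral_sum_measure]
        exact tsum_congr hP
    _ = P (⋃ n, E n) := (measure_iUnion hdisj hmE).symm
    _ ≤ _ := measure_mono hsub

theorem setLIntegral_exp_jumpMeasure_le_liminf [IsProbabilityMeasure P] (h : LGamma γ μ)
    (hmeas : ∀ n, Measurable (ξ n)) (hindep : iIndepFun ξ P) (hlaw : ∀ n, P.map (ξ n) = μ)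
    (a : ℝ) :
    ∫⁻ p in {p | p.1 ≤ a}, ENNReal.ofReal (Real.exp (γ * p.2)) ∂(jumpMeasure P ξ) ≤
      liminf (fun x : ℝ => P ({ω | (x : EReal) < allMax ξ ω} ∩
        ⋃ (n : ℕ) (_ : 1 ≤ n), jumpEvent ξ n a (x - a)) / tail μ x) atTop := by
  refine (h.lintegral_exp_le_liminf _ measurable_snd).trans (liminf_le_liminf ?_)
  filter_upwards [eventually_ge_atTop (2 * a)] with x hx
  gcongr
  exact setLIntegral_tail_jumpMeasure_le hmeas hindep hlaw hx

theorem tendsto_setLIntegral_exp_jumpMeasure :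
    Tendsto (fun n : ℕ => ∫⁻ p in {p | p.1 ≤ (n : ℝ)}, ENNReal.ofReal (Real.exp (γ * p.2))
      ∂(jumpMeasure P ξ)) atTop
      (𝓝 (∫⁻ p, ENNReal.ofReal (Real.exp (γ * p.2)) ∂(jumpMeasure P ξ))) := by
  have hmono : Monotone fun n : ℕ => {p : ℝ × ℝ | p.1 ≤ (n : ℝ)} := fun i j hij p hp =>
    le_trans (b := (i : ℝ)) hp (by exact_mod_cast hij)
  have hU : ⋃ n : ℕ, {p : ℝ × ℝ | p.1 ≤ (n : ℝ)} = Set.univ :=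
    Set.eq_univ_of_forall fun p => Set.mem_iUnion.2 (exists_nat_ge p.1)
  rw [← setLIntegral_univ, ← hU, setLIntegral_iUnion_of_directed _ hmono.directed_le]
  exact tendsto_atTop_iSup fun i j hij => lintegral_mono_set (hmono hij)

end SingleBigJump

/-! ### The main theorem. -/

theorem mainTheorem1 {Ω : Type*} [MeasurableSpace Ω] (P : Measure Ω) [IsProbabilityMeasure P]
    (μ : Measure ℝ) (γ : ℝ) (hγ : 0 < γ)
    (hμ : SingleBigJump.SGamma γ μ) (hφ : SingleBigJump.phi μ γ < 1)
    (ξ : ℕ → Ω → ℝ) (hmeas : ∀ n, Measurable (ξ n)) (hindep : iIndepFun ξ P)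
    (hlaw : ∀ n, P.map (ξ n) = μ) :
    SingleBigJump.expMax P ξ γ < ∞ ∧
    Tendsto (fun x : ℝ => P {ω | (x : EReal) < SingleBigJump.allMax ξ ω} / SingleBigJump.tail μ x)
      atTop (𝓝 (SingleBigJump.expMax P ξ γ / (1 - SingleBigJump.phi μ γ))) ∧
    ∀ ε : ℝ, 0 < ε → ∃ a : ℝ, 0 < a ∧
      ENNReal.ofReal (1 - ε) * (SingleBigJump.expMax P ξ γ / (1 - SingleBigJump.phi μ γ)) ≤
        liminf (fun x : ℝ =>
          P ({ω | (x : EReal) < SingleBigJump.allMax ξ ω} ∩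
              ⋃ (n : ℕ) (_ : 1 ≤ n), SingleBigJump.jumpEvent ξ n a (x - a)) /
            SingleBigJump.tail μ x) atTop ∧
      liminf (fun x : ℝ =>
          P ({ω | (x : EReal) < SingleBigJump.allMax ξ ω} ∩
              ⋃ (n : ℕ) (_ : 1 ≤ n), SingleBigJump.jumpEvent ξ n a (x - a)) /
            SingleBigJump.tail μ x) atTop ≤
        SingleBigJump.expMax P ξ γ / (1 - SingleBigJump.phi μ γ) := by
  open SingleBigJump in
  have hE := expMax_lt_top hγ hφ hmeas hindep hlaw
  have hc := lintegral_exp_jumpMeasure hγ hφ hmeas hindep hlaw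
  set c := expMax P ξ γ / (1 - phi μ γ)
  have hct : c ≠ ∞ := ENNReal.div_ne_top hE.ne (tsub_pos_of_lt hφ).ne'
  have hE0 : expMax P ξ γ ≠ 0 := by
    have : 1 ≤ expMax P ξ γ := by
      calc (1 : ℝ≥0∞) = ∫⁻ _, 1 ∂P := by simp
        _ ≤ _ := lintegral_mono fun ω => by
          rw [EReal.one_le_exp_iff]
          exact mul_nonneg (by exact_mod_cast hγ.le) (allMax_nonneg ξ ω)
    exact (zero_lt_one.trans_le this).ne'
  have hc0 : c ≠ 0 := by
    simp [c, hE0, ENNReal.div_eq_zero_iff]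
  have hlim := tendsto_setLIntegral_exp_jumpMeasure (P := P) (ξ := ξ) (γ := γ)
  rw [hc] at hlim
  have hlow := setLIntegral_exp_jumpMeasure_le_liminf hμ.toLGamma hmeas hindep hlaw
  have hle (a : ℝ) : liminf (fun x : ℝ => P ({ω | (x : EReal) < allMax ξ ω} ∩
        ⋃ (n : ℕ) (_ : 1 ≤ n), jumpEvent ξ n a (x - a)) / tail μ x) atTop ≤
      liminf (fun x : ℝ => P {ω | (x : EReal) < allMax ξ ω} / tail μ x) atTop := by
    refine liminf_le_liminf (Eventually.of_forall fun x => ?_)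
    gcongr
    exact Set.inter_subset_left
  have hup := limsup_measure_lt_allMax_le hγ hμ hφ hmeas hindep hlaw
  have htend : Tendsto (fun x : ℝ => P {ω | (x : EReal) < allMax ξ ω} / tail μ x) atTop (𝓝 c) :=
    tendsto_of_le_liminf_of_limsup_le
      (le_of_tendsto' hlim fun n => (hlow n).trans (hle n)) hup
  refine ⟨hE, htend, fun ε hε => ?_⟩
  -- Strictness, which needs `0 < c < ∞`, leaves room for a finite truncation level.
  have hlt : ENNReal.ofReal (1 - ε) * c < c := by
    calc _ < 1 * c := by
          refine ENNReal.mul_lt_mul_left hc0 hct ?_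
          rw [ENNReal.ofReal_lt_one]
          linarith
      _ = c := one_mul c
  obtain ⟨n, hn, hn0⟩ := ((hlim.eventually_const_lt hlt).and (eventually_gt_atTop 0)).exists
  exact ⟨n, by exact_mod_cast hn0, hn.le.trans (hlow n), (hle n).trans_eq htend.liminf_eq⟩
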